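/- **Conventions.** Let $n\ge 0$. A simplicial complex $\mathcal K$ of dimension $n$ is a nonempty collection of finite nonempty sets (its faces), closed under taking nonempty subsets, such that every face is contained in a face with exactly $n+1$ elements and no face has more than $n+1$ elements; its vertices are the elements of its faces. A set of $k+1$ vertices that is a face is a $k$-face (the empty set counts as the unique $(-1)$-face). We say that $\mathcal K$ is *of type $\{3,4\}$* if * (closed) every $(n-1)$-face is contained in exactly two $n$-faces; * (strongly connected) any two $n$-faces are joined by a chain of $n$-faces in which consecutive ones share an $(n-1)$-face; * every $(n-2)$-face is contained in exactly $3$ or exactly $4$ $n$-faces, i.e. its link is a cycle of length $3$ or $4$ (it is not required that both values occur). $\mathrm{Aut}(\mathcal K)$ is the group of permutations of the vertex set that preserve the set of faces. A *convex polytopal realization* of $\mathcal K$ (whose vertex set $V$ is then finite) is an injective map $\varphi:V\to\mathbb R^{n+1}$ such that $\mathcal P=\mathrm{conv}\,\varphi(V)$ is a full-dimensional convex polytope with vertex set $\varphi(V)$, $\varphi(F)$ is affinely independent for every face $F$ of $\mathcal K$, and the nonempty proper faces of $\mathcal P$ are exactly the simplices $\mathrm{conv}\,\varphi(F)$ with $F$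 a face of $\mathcal K$. **Proposition 2.6.** Every simplicial complex $\mathcal K$ of dimension $n$ and type $\{3,4\}$ has a convex polytopal realization $\varphi:V\to\mathbb R^{n+1}$, with polytope $\mathcal P=\mathrm{conv}\,\varphi(V)$, whose group of isometries $\mathrm{Isom}(\mathcal P)=\{g\in\mathrm{Isom}(\mathbb R^{n+1}) : g(\mathcal P)=\mathcal P\}$ coincides with $\mathrm{Aut}(\mathcal K)$: there is a group isomorphism $\Phi:\mathrm{Isom}(\mathcal P)\to\mathrm{Aut}(\mathcal K)$ with $g(\varphi(v))=\varphi(\Phi(g)(v))$ for all $g\in\mathrm{Isom}(\mathcal P)$ and $v\in V$. Moreover $\mathcal P$ can be chosen so that the origin is interior to $\mathcal P$ and the polar dual $\{y : \langle x,y\rangle\le 1 \text{ for all } x\in \mathcal P\}$ is, up to a linear isometry, an orthogonal product $\Delta_1\times\dots\times\Delta_t\subset\mathbb R^{m_1}\times\dots\times\mathbb R^{m_t}$ of regular simplices $\Delta_i$ of dimension $m_i\ge 1$. -/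

import Mathlib

/-! ### Abstract simplicial complexes of type `{3,4}` -/

/-- `S` is a face of dimension `n` (it has `n + 1` vertices) of the simplicial complex `K`. -/
def IsTopFace {V : Type*} (K : AbstractSimplicialComplex V) (n : ℕ) (S : Finset V) : Prop :=
  S ∈ K.faces ∧ S.card = n + 1

/-- `K` is a (nonempty) simplicial complex of pure dimension `n`: no face has more than `n + 1`
vertices, and every face lies in a face with exactly `n + 1` vertices. -/
structure IsPureOfDim {V : Type*} (K : AbstractSimplicialComplex V) (n : ℕ) : Prop where
  nonempty : K.faces.Nonempty
  card_le : ∀ S ∈ K.faces, S.card ≤ n + 1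
  exists_top : ∀ S ∈ K.faces, ∃ T, IsTopFace K n T ∧ S ⊆ T

/-- The number of `n`-faces of `K` that contain `F` (and `0` if there are infinitely many).
For an `(n-2)`-face `F` of a closed complex the sets `T \ F`, with `T` an `n`-face containing `F`,
are the edges of the link of `F`, so this number is the length of the link. -/
noncomputable def numTopFaces {V : Type*} (K : AbstractSimplicialComplex V) (n : ℕ)
    (F : Finset V) : ℕ :=
  {T : Finset V | IsTopFace K n T ∧ F ⊆ T}.ncard

/-- Every `(n-1)`-face of `K` lies in exactly two `n`-faces. -/
def IsClosedComplex {V : Type*} (K : AbstractSimplicialComplex V) (n : ℕ) : Prop :=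
  ∀ F S : Finset V, IsTopFace K n S → F ⊆ S → F.card = n → numTopFaces K n F = 2

/-- Any two `n`-faces are joined by a chain of `n`-faces in which consecutive ones share an
`(n-1)`-face. -/
def IsStronglyConnected {V : Type*} (K : AbstractSimplicialComplex V) (n : ℕ) : Prop :=
  ∀ S T : Finset V, IsTopFace K n S → IsTopFace K n T →
    Relation.ReflTransGen
      (fun A B : Finset V => IsTopFace K n A ∧ IsTopFace K n B ∧
        ∃ F : Finset V, F ⊆ A ∧ F ⊆ B ∧ F.card = n) S T

/-- `K` is an `n`-dimensional closed, strongly connected simplicial complex in which the link of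
every `(n-2)`-face has length `3` or `4`.  An `(n-2)`-face has `n - 1` vertices; for `n = 1` it is
the empty face, whose link is `K` itself. -/
structure IsType34 {V : Type*} (K : AbstractSimplicialComplex V) (n : ℕ) : Prop where
  pure : IsPureOfDim K n
  closed : IsClosedComplex K n
  connected : IsStronglyConnected K n
  link_length : ∀ F S : Finset V, IsTopFace K n S → F ⊆ S → F.card + 1 = n →
    numTopFaces K n F = 3 ∨ numTopFaces K n F = 4

/-- The automorphism group of `K`: the permutations of the vertices preserving the set of faces. -/
def autGroup {V : Type*} (K : AbstractSimplicialComplex V) : Subgroup (Equiv.Perm V) where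
  carrier := {σ | ∀ S : Finset V, S.map σ.toEmbedding ∈ K.faces ↔ S ∈ K.faces}
  one_mem' := by
    intro S
    have h : S.map (1 : Equiv.Perm V).toEmbedding = S := by
      ext x; simp; rfl
    rw [h]
  mul_mem' := by
    intro σ τ hσ hτ S
    have h : S.map (σ * τ).toEmbedding = (S.map τ.toEmbedding).map σ.toEmbedding := by
      rw [Finset.map_map]; rfl
    rw [h, hσ, hτ]
  inv_mem' := by
    intro σ hσ S
    have h : (S.map (σ⁻¹).toEmbedding).map σ.toEmbedding = S := by
      rw [Finset.map_map]
      ext x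
      simp
    rw [← hσ, h]

/-! ### Convex polytopes -/

/-- The Euclidean isometries (of the whole space `E`) that map `P` onto itself. -/
def isometryGroupOf {E : Type*} [PseudoEMetricSpace E] (P : Set E) : Subgroup (E ≃ᵢ E) where
  carrier := {g | g '' P = P}
  one_mem' := Set.image_id P
  mul_mem' := by
    intro g h hg hh
    change (fun x => g (h x)) '' P = P
    rw [← Set.image_image g h, hh, hg]
  inv_mem' := by
    intro g hg
    change g.symm '' P = P
    have hg' : g '' P = P := hg
    conv_lhs => rw [← hg']
    rw [Set.image_image]
    simp

/-- The convex polytope spanned by the points `φ v` realizes `K`: `K` has finitely many vertices,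
`φ` maps them bijectively onto the vertices of a full-dimensional convex polytope, the faces of `K`
are mapped to affinely independent sets, and the nonempty proper faces of the polytope are exactly
the simplices spanned by the (images of the) faces of `K`. -/
structure IsPolytopalRealization {V E : Type*} [NormedAddCommGroup E] [InnerProductSpace ℝ E]
    (K : AbstractSimplicialComplex V) (φ : V → E) : Prop where
  finite : Finite V
  injective : Function.Injective φ
  full_dim : (interior (convexHull ℝ (Set.range φ))).Nonempty
  vertices : (convexHull ℝ (Set.range φ)).extremePoints ℝ = Set.range φ
  simplices : ∀ F ∈ K.faces, AffineIndependent ℝ (fun v : F => φ v)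
  faces : ∀ B : Set E,
    (B.Nonempty ∧ B ≠ convexHull ℝ (Set.range φ) ∧ IsExposed ℝ (convexHull ℝ (Set.range φ)) B) ↔
      ∃ F ∈ K.faces, B = convexHull ℝ (φ '' (F : Set V))

/-- The polar dual of `P` with respect to the origin. -/
def polarDual {E : Type*} [NormedAddCommGroup E] [InnerProductSpace ℝ E] (P : Set E) : Set E :=
  {y | ∀ x ∈ P, inner ℝ x y ≤ 1}

/-- The origin is interior to `P`, and the polar dual of `P` is, up to a linear isometry, an
orthogonal product of regular simplices of positive dimensions `m i`. -/
def IsPolarDualOfSimplexProduct {E : Type*} [NormedAddCommGroup E] [InnerProductSpace ℝ E]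
    (P : Set E) : Prop :=
  (0 : E) ∈ interior P ∧
    ∃ (t : ℕ) (m : Fin t → ℕ)
      (Δ : ∀ i, Affine.Simplex ℝ (EuclideanSpace ℝ (Fin (m i))) (m i))
      (e : E ≃ₗᵢ[ℝ] PiLp 2 (fun i => EuclideanSpace ℝ (Fin (m i)))),
      (∀ i, 0 < m i ∧ (Δ i).Equilateral) ∧
        e '' polarDual P = {x | ∀ i, x i ∈ convexHull ℝ (Set.range (Δ i).points)}

/-! ### Neighbouring facets and codimension-two links -/

section Combinatorics

variable {V : Type*} {K : AbstractSimplicialComplex V} {n : ℕ}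

/-! The short links force `K` to be a join of boundaries of simplices. Fix a facet `S` and let `w v`
be the vertex that replaces `v` in the facet across from `v`. Group the vertices of `S` by the value
of `w` and add that value to its group: these are the blocks, each with at least two elements. `S`
omits one vertex of each block, and `IsType34.square` shows that exchanging a vertex for the omitted
one of its block preserves this picture (`IsGoodTransversal.update`). By strong connectedness every
facet arises so, hence a nonempty set is a face exactly when it contains no block.

Such a join is the boundary of the convex hull of regular simplices placed in mutually orthogonal
subspaces, all centred at the origin. Scaling them to the same edge length makes the vertices a
tight frame, with the projection onto functions of zero sum on every block as Gram matrix
(`IsBlockFrame`). Linear functionals on the space are then the same as such functions, which yields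
the face structure (`IsBlockFrame.isPolytopalRealization`).

Automorphisms are the permutations preserving the partition, because the blocks are the minimal
non-faces. They preserve the Gram matrix, so they extend to isometries; conversely an isometry of
the polytope permutes its vertices and preserves the partition, because vertices of one block are at
distance `√2` and vertices of different blocks are closer. The inequalities of the polar dual
involve one block each, so the dual is a product of regular simplices. -/

theorem mem_faces_of_subset {F T : Finset V} (hT : T ∈ K.faces) (hF : F.Nonempty) (h : F ⊆ T) :
    F ∈ K.faces :=
  (K.isRelLowerSet_faces hT).2 h hF

variable [DecidableEq V]

/-- Every facet of a closed complex has exactly one neighbour opposite to each of its vertices. -/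
theorem IsClosedComplex.exists_neighbour (hK : IsClosedComplex K n) {T : Finset V}
    (hT : IsTopFace K n T) {v : V} (hv : v ∈ T) :
    ∃ w ∉ T, IsTopFace K n (insert w (T.erase v)) ∧
      ∀ T', IsTopFace K n T' → T.erase v ⊆ T' → T' = T ∨ T' = insert w (T.erase v) := by
  have hc : (T.erase v).card = n := by rw [Finset.card_erase_of_mem hv, hT.2]; rfl
  have h2 := hK _ _ hT (T.erase_subset v) hc
  obtain ⟨A, B, hAB, hs⟩ := Set.ncard_eq_two.1 h2
  have key : ∀ B, IsTopFace K n B → T.erase v ⊆ B → B ≠ T →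
      ∃ w ∉ T, B = insert w (T.erase v) := by
    intro B hB hsub hne
    have h1 : (B \ T.erase v).card = 1 := by
      rw [Finset.card_sdiff_of_subset hsub, hB.2, hc]; omega
    obtain ⟨w, hw⟩ := Finset.card_eq_one.1 h1
    have hB' : B = insert w (T.erase v) := by
      rw [← Finset.sdiff_union_of_subset hsub, hw]; rfl
    refine ⟨w, fun hwT => hne ?_, hB'⟩
    have hwv : w = v := by
      by_contra h
      have : w ∈ B \ T.erase v := by rw [hw]; simp
      exact (Finset.mem_sdiff.1 this).2 (Finset.mem_erase.2 ⟨h, hwT⟩)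
    rw [hB', hwv, Finset.insert_erase hv]
  have hmem : ∀ T', (IsTopFace K n T' ∧ T.erase v ⊆ T') ↔ T' = A ∨ T' = B := by
    intro T'
    have := Set.ext_iff.1 hs T'
    simpa using this
  obtain ⟨C, hC, hCT, hall⟩ : ∃ C, (IsTopFace K n C ∧ T.erase v ⊆ C) ∧ C ≠ T ∧
      ∀ T', IsTopFace K n T' → T.erase v ⊆ T' → T' = T ∨ T' = C := by
    rcases (hmem T).1 ⟨hT, T.erase_subset v⟩ with h | h
    · exact ⟨B, (hmem B).2 (Or.inr rfl), fun h' => hAB (h.symm.trans h'.symm), fun T' h1 h2 => by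
        rw [h]; exact (hmem T').1 ⟨h1, h2⟩⟩
    · exact ⟨A, (hmem A).2 (Or.inl rfl), fun h' => hAB (h'.trans h), fun T' h1 h2 => by
        rw [h]; exact ((hmem T').1 ⟨h1, h2⟩).symm⟩
  obtain ⟨w, hw, rfl⟩ := key C hC.1 hC.2 hCT
  exact ⟨w, hw, hC.1, hall⟩

/-- If the facets opposite to two vertices of a facet have distinct new vertices, then the four
facets around the corresponding codimension two face form a square. -/
theorem IsType34.square (hK : IsType34 K n) {T : Finset V} (hT : IsTopFace K n T) {u v w x : V}
    (hu : u ∈ T) (hv : v ∈ T) (huv : u ≠ v) (hw : w ∉ T) (hx : x ∉ T) (hwx : w ≠ x)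
    (hTv : IsTopFace K n (insert w (T.erase v))) (hTu : IsTopFace K n (insert x (T.erase u))) :
    IsTopFace K n (insert w (insert x ((T.erase u).erase v))) := by
  set F := (T.erase u).erase v with hF
  have hvu : v ∈ T.erase u := Finset.mem_erase.2 ⟨huv.symm, hv⟩
  have hFc : F.card + 1 = n := by
    have h1 : F.card + 1 = _ := Finset.card_erase_add_one hvu
    have h2 := Finset.card_erase_add_one hu
    have h3 := hT.2
    omega
  have hFT : F ⊆ T := (Finset.erase_subset _ _).trans (Finset.erase_subset _ _)
  have hlink := hK.link_length F T hT hFT hFc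
  obtain ⟨y, hy, hT3, -⟩ := hK.closed.exists_neighbour hTv (v := u) (by grind)
  obtain ⟨z, hz, hT4, -⟩ := hK.closed.exists_neighbour hTu (v := v) (by grind)
  have e3 : insert y ((insert w (T.erase v)).erase u) = insert y (insert w F) := by grind
  have e4 : insert z ((insert x (T.erase u)).erase v) = insert z (insert x F) := by grind
  rw [e3] at hT3
  rw [e4] at hT4
  by_contra hcon
  have hyx : y ≠ x := by
    rintro rfl
    exact hcon (by rwa [Finset.insert_comm])
  -- `ncard` is `0` on infinite sets, so a link length of 3 or 4 also gives finiteness.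
  have hfin : {T' : Finset V | IsTopFace K n T' ∧ F ⊆ T'}.Finite := by
    apply Set.finite_of_ncard_ne_zero
    change numTopFaces K n F ≠ 0
    omega
  -- If the square does not close up, these five facets around `F` are distinct, but there are at
  -- most four.
  have hsub : (({T, insert w (T.erase v), insert x (T.erase u), insert y (insert w F),
      insert z (insert x F)} : Finset (Finset V)) : Set (Finset V)) ⊆
      {T' : Finset V | IsTopFace K n T' ∧ F ⊆ T'} := by
    intro T' hT'
    simp only [Finset.coe_insert, Finset.coe_singleton, Set.mem_insert_iff,
      Set.mem_singleton_iff] at hT'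
    rcases hT' with rfl | rfl | rfl | rfl | rfl
    · exact ⟨hT, hFT⟩
    · exact ⟨hTv, by grind⟩
    · exact ⟨hTu, by grind⟩
    · exact ⟨hT3, by grind⟩
    · exact ⟨hT4, by grind⟩
  have hcard := Set.ncard_le_ncard hsub hfin
  rw [Set.ncard_coe_finset] at hcard
  have h5 : ({T, insert w (T.erase v), insert x (T.erase u), insert y (insert w F),
      insert z (insert x F)} : Finset (Finset V)).card = 5 := by
    rw [Finset.card_insert_of_notMem, Finset.card_insert_of_notMem, Finset.card_insert_of_notMem,
      Finset.card_pair]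
    · intro h
      have : x ∈ insert y (insert w F) := h ▸ by simp
      grind
    · simp only [Finset.mem_insert, Finset.mem_singleton, not_or]
      refine ⟨fun h => ?_, fun h => ?_⟩
      · have : w ∈ insert x (T.erase u) := h ▸ by simp
        grind
      · have : v ∈ insert z (insert x F) := h ▸ by simp [hvu]
        grind
    · simp only [Finset.mem_insert, Finset.mem_singleton, not_or]
      refine ⟨fun h => ?_, fun h => ?_, fun h => ?_⟩
      · have : w ∈ insert x (T.erase u) := h ▸ by simp
        grind
      · have : u ∈ insert y (insert w F) := h ▸ by simp [hu, huv]
        grind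
      · have : x ∈ insert w (T.erase v) := h ▸ by simp
        grind
    · simp only [Finset.mem_insert, Finset.mem_singleton, not_or]
      refine ⟨fun h => hw (h ▸ by simp), fun h => hx (h ▸ by simp), fun h => hw (h ▸ by simp),
        fun h => hx (h ▸ by simp)⟩
  have h4 : {T' : Finset V | IsTopFace K n T' ∧ F ⊆ T'}.ncard ≤ 4 := by
    change numTopFaces K n F ≤ 4
    omega
  omega

end Combinatorics

/-! ### Facets as complements of transversals -/

section Combinatorics

variable {V : Type*} {K : AbstractSimplicialComplex V} {n : ℕ} [DecidableEq V]

/-- The set of vertices in `U` that are not chosen by `μ` as a representative of their block, where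
`β` maps every vertex to (the label of) its block. -/
def unchosen (U : Finset V) (β μ : V → V) : Finset V :=
  U.filter fun v => μ (β v) ≠ v

/-- The complement of the transversal `μ` of the blocks is a facet, and the facet opposite to any of
its vertices is obtained by exchanging this vertex for the missing vertex of its block. -/
structure IsGoodTransversal (K : AbstractSimplicialComplex V) (n : ℕ) (U W : Finset V)
    (β μ : V → V) : Prop where
  section_of : ∀ a ∈ W, β (μ a) = a
  mem : ∀ a ∈ W, μ a ∈ U
  facet : IsTopFace K n (unchosen U β μ)
  exchange : ∀ v ∈ unchosen U β μ,
    IsTopFace K n (insert (μ (β v)) ((unchosen U β μ).erase v))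

theorem unchosen_update {U W : Finset V} {β μ : V → V} (hβ : ∀ u ∈ U, β u ∈ W)
    (hsec : ∀ a ∈ W, β (μ a) = a) (hmem : ∀ a ∈ W, μ a ∈ U) {v : V}
    (hv : v ∈ unchosen U β μ) :
    unchosen U β (Function.update μ (β v) v) = insert (μ (β v)) ((unchosen U β μ).erase v) := by
  have hvU : v ∈ U := (Finset.mem_filter.1 hv).1
  have hvne : μ (β v) ≠ v := (Finset.mem_filter.1 hv).2
  ext u
  simp only [unchosen, Finset.mem_filter, Finset.mem_insert, Finset.mem_erase, Function.update_apply]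
  have h1 := hsec _ (hβ v hvU)
  have h2 := hmem _ (hβ v hvU)
  constructor
  · rintro ⟨hu, h⟩
    split_ifs at h with hb
    · by_cases h' : u = μ (β v)
      · exact Or.inl h'
      · exact Or.inr ⟨h.symm, hu, by rw [hb]; exact fun h3 => h' h3.symm⟩
    · exact Or.inr ⟨fun h' => hb (by rw [h']), hu, h⟩
  · rintro (rfl | ⟨h3, h4, h5⟩)
    · refine ⟨h2, ?_⟩
      rw [if_pos h1]
      exact hvne.symm
    · refine ⟨h4, ?_⟩
      split_ifs with hb
      · exact h3.symm
      · exact h5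

/-- Only the exchange condition at the new facet needs an argument. Undoing the exchange returns the
old facet; for another vertex of the same block the required facet is already a neighbour of the old
one; for a vertex of another block it is the fourth facet of a square. -/
theorem IsGoodTransversal.update (hK : IsType34 K n) {U W : Finset V} {β μ : V → V}
    (hβ : ∀ u ∈ U, β u ∈ W) (h : IsGoodTransversal K n U W β μ) {v : V}
    (hv : v ∈ unchosen U β μ) :
    IsGoodTransversal K n U W β (Function.update μ (β v) v) := by
  have hup := unchosen_update hβ h.section_of h.mem hv
  have hvU : v ∈ U := (Finset.mem_filter.1 hv).1
  have hnot : ∀ a ∈ W, μ a ∉ unchosen U β μ := fun a ha h' =>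
    (Finset.mem_filter.1 h').2 (by rw [h.section_of a ha])
  have hwT := hnot _ (hβ v hvU)
  refine ⟨fun a ha => ?_, fun a ha => ?_, ?_, ?_⟩
  · rw [Function.update_apply]
    split_ifs with h'
    · exact h'.symm
    · exact h.section_of a ha
  · rw [Function.update_apply]
    split_ifs with h'
    · exact hvU
    · exact h.mem a ha
  · rw [hup]
    exact h.exchange v hv
  · rw [hup]
    intro u hu
    rw [Function.update_apply]
    rcases Finset.mem_insert.1 hu with rfl | hu'
    · rw [if_pos (h.section_of _ (hβ v hvU)),
        Finset.erase_insert (fun h' => hwT (Finset.mem_of_mem_erase h')), Finset.insert_erase hv]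
      exact h.facet
    · have huT := Finset.mem_of_mem_erase hu'
      have huv := Finset.ne_of_mem_erase hu'
      have huU : u ∈ U := (Finset.mem_filter.1 huT).1
      split_ifs with hb
      · have := h.exchange u huT
        rw [hb] at this
        convert this using 1
        grind
      · have hx := hnot _ (hβ u huU)
        have hwx : μ (β u) ≠ μ (β v) := fun h' => hb (by
          rw [← h.section_of _ (hβ u huU), h', h.section_of _ (hβ v hvU)])
        have := hK.square h.facet hv huT huv.symm hx hwT hwx (h.exchange u huT) (h.exchange v hv)
        convert this using 1
        grind

/-- The facets of a complex of type `{3,4}` are exactly the complements of the transversals of a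
partition of the vertices. -/
theorem IsType34.exists_labels (hK : IsType34 K n) :
    ∃ (U W : Finset V) (β : V → V), (∀ v, v ∈ U) ∧ (∀ v, β v ∈ W) ∧
      (∀ a ∈ W, ∃ u v, u ≠ v ∧ β u = a ∧ β v = a) ∧ U.card = n + 1 + W.card ∧
      ∀ F : Finset V, F ∈ K.faces ↔ F.Nonempty ∧ ∀ a ∈ W, ∃ u, β u = a ∧ u ∉ F := by
  obtain ⟨S', hS'⟩ := hK.pure.nonempty
  obtain ⟨S, hS, -⟩ := hK.pure.exists_top S' hS'
  have hopp : ∀ v : V, ∃ w, v ∈ S → w ∉ S ∧ IsTopFace K n (insert w (S.erase v)) := by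
    intro v
    by_cases hv : v ∈ S
    · obtain ⟨w, h1, h2, -⟩ := hK.closed.exists_neighbour hS hv
      exact ⟨w, fun _ => ⟨h1, h2⟩⟩
    · exact ⟨v, fun h => (hv h).elim⟩
  choose w hw using hopp
  set W := S.image w with hW
  have hdisj : Disjoint S W := by
    rw [Finset.disjoint_left]
    intro a ha haW
    obtain ⟨v, hv, rfl⟩ := Finset.mem_image.1 haW
    exact (hw v hv).1 ha
  set U := S ∪ W with hU
  -- Blocks are labelled by their element in `W`, the vertex that `S` omits.
  set β : V → V := fun v => if v ∈ S then w v else v with hβdef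
  have hβS : ∀ v ∈ S, β v = w v := fun v hv => if_pos hv
  have hβW : ∀ v ∈ W, β v = v := fun v hv => if_neg (Finset.disjoint_right.1 hdisj hv)
  have hβ : ∀ u ∈ U, β u ∈ W := by
    intro u hu
    rcases Finset.mem_union.1 hu with h | h
    · rw [hβS u h]; exact Finset.mem_image_of_mem _ h
    · rw [hβW u h]; exact h
  have hid : unchosen U β id = S := by
    ext u
    simp only [unchosen, Finset.mem_filter, id]
    constructor
    · rintro ⟨h1, h2⟩
      rcases Finset.mem_union.1 h1 with h | h
      · exact h
      · exact (h2 (hβW u h)).elim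
    · intro h
      refine ⟨Finset.mem_union_left _ h, fun h' => (hw u h).1 ?_⟩
      rw [← hβS u h, h']
      exact h
  have hgood0 : IsGoodTransversal K n U W β id := by
    refine ⟨hβW, fun a ha => Finset.mem_union_right _ ha, by rwa [hid], ?_⟩
    rw [hid]
    intro v hv
    rw [id, hβS v hv]
    exact (hw v hv).2
  -- every transversal is reached by exchanges
  have hall : ∀ μ : V → V, (∀ a ∈ W, β (μ a) = a) → (∀ a ∈ W, μ a ∈ U) → ∀ A : Finset V, A ⊆ W →
      IsGoodTransversal K n U W β (fun a => if a ∈ A then μ a else a) := by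
    intro μ hμ hμU A
    -- `A` is the set of blocks already switched from the initial choice to `μ`; a further block
    -- costs one exchange, or none if `μ a = a`.
    induction A using Finset.induction_on with
    | empty => exact fun _ => hgood0
    | insert a A ha ih =>
      intro hA
      have haW : a ∈ W := hA (Finset.mem_insert_self _ _)
      have ih' := ih fun x hx => hA (Finset.mem_insert_of_mem hx)
      by_cases hμa : μ a = a
      · convert ih' using 2 with b
        grind
      · have hmem : μ a ∈ unchosen U β (fun a => if a ∈ A then μ a else a) := by
          simp only [unchosen, Finset.mem_filter, hμ a haW, if_neg ha]
          exact ⟨hμU a haW, fun h => hμa h.symm⟩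
        have := ih'.update hK hβ hmem
        convert this using 1
        funext b
        rw [hμ a haW, Function.update_apply]
        grind
  -- every facet is the complement of a transversal
  have hfacets : ∀ T, IsTopFace K n T → ∃ μ, IsGoodTransversal K n U W β μ ∧
      T = unchosen U β μ := by
    intro T hT
    have hchain := hK.connected S T hS hT
    clear hT
    induction hchain with
    | refl => exact ⟨id, hgood0, hid.symm⟩
    | @tail A B _ hAB ih =>
      obtain ⟨μ, hμ, rfl⟩ := ih
      obtain ⟨hA, hB, F, hFA, hFB, hF⟩ := hAB
      obtain ⟨v, hv, rfl⟩ : ∃ v ∈ unchosen U β μ, F = (unchosen U β μ).erase v := by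
        have h1 : (unchosen U β μ \ F).card = 1 := by
          rw [Finset.card_sdiff_of_subset hFA, hA.2, hF]; omega
        obtain ⟨v, hv⟩ := Finset.card_eq_one.1 h1
        have hv' : v ∈ unchosen U β μ \ F := by rw [hv]; simp
        refine ⟨v, (Finset.mem_sdiff.1 hv').1, ?_⟩
        rw [Finset.erase_eq, ← hv, Finset.sdiff_sdiff_eq_self hFA]
      -- A ridge lies in only two facets, so the next facet of the chain is the current one or its
      -- exchange at `v`.
      obtain ⟨x, -, hx, huniq⟩ := hK.closed.exists_neighbour hA hv
      have hvU : v ∈ U := (Finset.mem_filter.1 hv).1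
      have hex := hμ.exchange v hv
      have hne : insert (μ (β v)) ((unchosen U β μ).erase v) ≠ unchosen U β μ := by
        intro h
        have : μ (β v) ∈ unchosen U β μ := h ▸ Finset.mem_insert_self _ _
        exact (Finset.mem_filter.1 this).2 (by rw [hμ.section_of _ (hβ v hvU)])
      have h1 := (huniq _ hex (Finset.subset_insert _ _)).resolve_left hne
      rcases huniq B hB hFB with rfl | rfl
      · exact ⟨μ, hμ, rfl⟩
      · exact ⟨_, hμ.update hK hβ hv,
          by rw [unchosen_update hβ hμ.section_of hμ.mem hv, h1]⟩
  have huniv : ∀ v, v ∈ U := by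
    intro v
    obtain ⟨T, hT, hvT⟩ := hK.pure.exists_top _ (K.singleton_mem v)
    obtain ⟨μ, -, rfl⟩ := hfacets T hT
    exact (Finset.mem_filter.1 (hvT (Finset.mem_singleton_self v))).1
  refine ⟨U, W, β, huniv, fun v => hβ v (huniv v), ?_, ?_, ?_⟩
  · intro a ha
    obtain ⟨v, hv, rfl⟩ := Finset.mem_image.1 ha
    exact ⟨v, w v, fun h => (hw v hv).1 (h ▸ hv), hβS v hv, hβW _ ha⟩
  · rw [hU, Finset.card_union_of_disjoint hdisj, hS.2]
  · intro F
    constructor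
    · intro hF
      refine ⟨(K.isRelLowerSet_faces hF).1, fun a ha => ?_⟩
      obtain ⟨T, hT, hFT⟩ := hK.pure.exists_top _ hF
      obtain ⟨μ, hμ, rfl⟩ := hfacets T hT
      refine ⟨μ a, hμ.section_of a ha, fun h => ?_⟩
      exact (Finset.mem_filter.1 (hFT h)).2 (by rw [hμ.section_of a ha])
    · rintro ⟨hne, hF⟩
      have : ∀ a, ∃ u, a ∈ W → β u = a ∧ u ∉ F := by
        intro a
        by_cases ha : a ∈ W
        · obtain ⟨u, hu⟩ := hF a ha
          exact ⟨u, fun _ => hu⟩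
        · exact ⟨a, fun h => (ha h).elim⟩
      choose μ hμ using this
      have hg := hall μ (fun a ha => (hμ a ha).1) (fun a _ => huniv _) W subset_rfl
      refine mem_faces_of_subset hg.facet.1 hne fun v hv => ?_
      simp only [unchosen, Finset.mem_filter]
      refine ⟨huniv v, fun h => ?_⟩
      rw [if_pos (hβ v (huniv v))] at h
      exact (hμ _ (hβ v (huniv v))).2 (by rw [h]; exact hv)

end Combinatorics

/-- The cardinality formula holds because a facet omits exactly one vertex of each of the `t`
blocks; it will make the dimension come out as `n + 1`. -/
theorem IsType34.exists_block_structure {V : Type*} {K : AbstractSimplicialComplex V} {n : ℕ}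
    (hK : IsType34 K n) :
    Finite V ∧ ∃ (t : ℕ) (β : V → Fin t), (∀ i, ∃ u v, u ≠ v ∧ β u = i ∧ β v = i) ∧
      Nat.card V = n + 1 + t ∧
      ∀ F : Finset V, F ∈ K.faces ↔ F.Nonempty ∧ ∀ i, ∃ u, β u = i ∧ u ∉ F := by
  classical
  obtain ⟨U, W, β, hU, hβ, htwo, hcard, hfaces⟩ := hK.exists_labels
  let ε := W.equivFin
  refine ⟨Set.finite_univ_iff.1 (U.finite_toSet.subset fun v _ => hU v), W.card,
    fun v => ε ⟨β v, hβ v⟩, fun i => ?_, ?_, fun F => ?_⟩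
  · obtain ⟨u, v, h1, h2, h3⟩ := htwo _ (ε.symm i).2
    refine ⟨u, v, h1, ?_, ?_⟩ <;> rw [← Equiv.eq_symm_apply] <;> exact Subtype.ext ‹_›
  · rw [← hcard, ← Set.ncard_univ, ← Set.ncard_coe_finset]
    congr 1
    ext v
    simp [hU v]
  · rw [hfaces]
    refine and_congr_right fun _ => ⟨fun h i => ?_, fun h a ha => ?_⟩
    · obtain ⟨u, h1, h2⟩ := h _ (ε.symm i).2
      exact ⟨u, by rw [← Equiv.eq_symm_apply]; exact Subtype.ext h1, h2⟩
    · obtain ⟨u, h1, h2⟩ := h (ε ⟨a, ha⟩)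
      exact ⟨u, congrArg Subtype.val (ε.injective h1), h2⟩

/-! ### Metric properties of block frames -/

section BlockFrame

open scoped RealInnerProductSpace

/-- The vectors `φ v` form a tight frame of `E` whose Gram matrix is the orthogonal projection onto
the functions `V → ℝ` with sum zero over every block `β ⁻¹' {i}`. -/
structure IsBlockFrame {V ι E : Type*} [Fintype V] [DecidableEq V] [DecidableEq ι]
    [NormedAddCommGroup E] [InnerProductSpace ℝ E] (β : V → ι) (φ : V → E) : Prop where
  inner_eq : ∀ u v, ⟪φ u, φ v⟫ = (if u = v then 1 else 0) -
    if β u = β v then ((Finset.univ.filter fun w => β w = β u).card : ℝ)⁻¹ else 0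
  sum_smul : ∀ x, ∑ v, ⟪φ v, x⟫ • φ v = x

namespace IsBlockFrame

theorem card_block_pos {V ι : Type*} [Fintype V] [DecidableEq ι] (β : V → ι) (v : V) :
    0 < ((Finset.univ.filter fun w => β w = β v).card : ℝ) := by
  exact_mod_cast Finset.card_pos.2 ⟨v, by simp⟩

variable {V ι E : Type*} [Fintype V] [DecidableEq V] [DecidableEq ι]
  [NormedAddCommGroup E] [InnerProductSpace ℝ E] {β : V → ι} {φ : V → E}

/-- The Gram matrix acts on coefficients by subtracting the block average. -/
theorem inner_sum_smul (h : IsBlockFrame β φ) (y : V → ℝ) (v : V) :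
    ⟪φ v, ∑ u, y u • φ u⟫ = y v -
      ((Finset.univ.filter fun w => β w = β v).card : ℝ)⁻¹ *
        ∑ u ∈ Finset.univ.filter (fun w => β w = β v), y u := by
  simp_rw [inner_sum, inner_smul_right, h.inner_eq, mul_sub, Finset.sum_sub_distrib]
  congr 1
  · simp
  · rw [Finset.mul_sum, Finset.sum_filter]
    refine Finset.sum_congr rfl fun u _ => ?_
    by_cases hb : β v = β u
    · rw [if_pos hb, if_pos hb.symm, mul_comm]
    · rw [if_neg hb, if_neg (Ne.symm hb), mul_zero]

/-- Every function with sum zero over the blocks is the coordinate function of a vector. -/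
theorem exists_inner_eq (h : IsBlockFrame β φ) (y : V → ℝ)
    (hy : ∀ i, ∑ u ∈ Finset.univ.filter (fun w => β w = i), y u = 0) :
    ∃ x : E, ∀ v, ⟪φ v, x⟫ = y v :=
  ⟨∑ u, y u • φ u, fun v => by rw [h.inner_sum_smul, hy, mul_zero, sub_zero]⟩

theorem eq_of_inner_eq (h : IsBlockFrame β φ) {x y : E} (hxy : ∀ v, ⟪φ v, x⟫ = ⟪φ v, y⟫) :
    x = y := by
  rw [← h.sum_smul x, ← h.sum_smul y]
  simp_rw [hxy]

theorem sum_block (h : IsBlockFrame β φ) (i : ι) :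
    ∑ v ∈ Finset.univ.filter (fun w => β w = i), φ v = 0 := by
  apply h.eq_of_inner_eq
  intro v
  have h1 : ∑ v ∈ Finset.univ.filter (fun w => β w = i), φ v =
      ∑ v, (if β v = i then (1 : ℝ) else 0) • φ v := by
    rw [Finset.sum_filter]
    exact Finset.sum_congr rfl fun u _ => by split_ifs <;> simp
  rw [h1, h.inner_sum_smul, inner_zero_right]
  by_cases hv : β v = i
  · have h2 : ∑ u ∈ Finset.univ.filter (fun w => β w = β v), (if β u = i then (1 : ℝ) else 0) =
        (Finset.univ.filter fun w => β w = β v).card := by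
      rw [Finset.sum_congr rfl (g := fun _ => (1 : ℝ)) (fun u hu => by
        rw [if_pos ((Finset.mem_filter.1 hu).2.trans hv)])]
      simp
    rw [h2, if_pos hv, inv_mul_cancel₀ (card_block_pos β v).ne', sub_self]
  · rw [if_neg hv, Finset.sum_eq_zero, mul_zero, sub_self]
    intro u hu
    rw [if_neg]
    rw [(Finset.mem_filter.1 hu).2]
    exact hv

theorem sum_eq_zero [Fintype ι] (h : IsBlockFrame β φ) : ∑ v, φ v = 0 := by
  rw [← Finset.sum_fiberwise Finset.univ β]
  exact Finset.sum_eq_zero fun i _ => h.sum_block i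

/-- A vector whose coordinates are at least `-1 / |V|` is a convex combination of the `φ v`. -/
theorem mem_convexHull [Fintype ι] [Nonempty V] (h : IsBlockFrame β φ) {x : E}
    (hx : ∀ v, -(Fintype.card V : ℝ)⁻¹ ≤ ⟪φ v, x⟫) : x ∈ convexHull ℝ (Set.range φ) := by
  -- Since the `φ v` sum to zero, adding a constant to the frame coefficients leaves the vector
  -- unchanged; this constant makes the weights sum to one.
  refine mem_convexHull_of_exists_fintype (fun v => ⟪φ v, x⟫ + (Fintype.card V : ℝ)⁻¹) φ
    (fun v => by linarith [hx v]) ?_ (fun v => Set.mem_range_self v) ?_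
  · rw [Finset.sum_add_distrib, ← sum_inner, h.sum_eq_zero, inner_zero_left]
    simp
  · simp_rw [add_smul]
    rw [Finset.sum_add_distrib, h.sum_smul, ← Finset.smul_sum, h.sum_eq_zero, smul_zero, add_zero]

theorem zero_mem_interior [Fintype ι] [Nonempty V] (h : IsBlockFrame β φ) :
    (0 : E) ∈ interior (convexHull ℝ (Set.range φ)) := by
  have hopen : IsOpen {x : E | ∀ v, -(Fintype.card V : ℝ)⁻¹ < ⟪φ v, x⟫} := by
    simp only [Set.ofPred_forall]
    refine isOpen_iInter_of_finite fun v => isOpen_lt continuous_const ?_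
    fun_prop
  refine mem_interior.2 ⟨_, fun x hx => h.mem_convexHull fun v => (hx v).le, hopen, fun v => ?_⟩
  rw [inner_zero_right, neg_lt_zero]
  positivity

theorem inner_self_pos (h : IsBlockFrame β φ) (hβ : ∀ i, ∃ u v, u ≠ v ∧ β u = i ∧ β v = i)
    (v : V) : 0 < ⟪φ v, φ v⟫ := by
  rw [h.inner_eq, if_pos rfl, if_pos rfl, sub_pos]
  apply inv_lt_one_of_one_lt₀
  obtain ⟨a, b, hab, ha, hb⟩ := hβ (β v)
  exact_mod_cast Finset.one_lt_card.2 ⟨a, by simp [ha], b, by simp [hb], hab⟩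

theorem inner_nonpos (h : IsBlockFrame β φ) {u v : V} (huv : u ≠ v) : ⟪φ u, φ v⟫ ≤ 0 := by
  rw [h.inner_eq, if_neg huv]
  have := inv_nonneg.2 (card_block_pos β u).le
  split_ifs <;> linarith

theorem injective (h : IsBlockFrame β φ) (hβ : ∀ i, ∃ u v, u ≠ v ∧ β u = i ∧ β v = i) :
    Function.Injective φ := by
  intro u v huv
  by_contra hne
  have h1 := h.inner_nonpos hne
  rw [← huv] at h1
  linarith [h.inner_self_pos hβ u]

/-- With block sizes `k` and `l`, the squared norms are `1 - 1/k` and `1 - 1/l`. Different blocks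
are orthogonal, so the squared distance is `2 - 1/k - 1/l < 2`; within a block the inner product
`-1/k` restores the missing amount. -/
theorem dist_sq_eq_two_iff (h : IsBlockFrame β φ) {u v : V} (huv : u ≠ v) :
    dist (φ u) (φ v) ^ 2 = 2 ↔ β u = β v := by
  rw [dist_eq_norm, norm_sub_sq_real, ← real_inner_self_eq_norm_sq, ← real_inner_self_eq_norm_sq,
    h.inner_eq, h.inner_eq, h.inner_eq]
  have hu := inv_pos.2 (card_block_pos β u)
  have hv := inv_pos.2 (card_block_pos β v)
  by_cases hb : β u = β v
  · simp only [hb, huv]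
    simp
    ring
  · simp only [hb, huv, if_true, if_false, iff_false]
    intro h'
    linarith

/-- The vectors indexed by a set that contains no block are linearly independent. -/
theorem linearIndependent (h : IsBlockFrame β φ) {F : Finset V}
    (hF : ∀ i, ∃ u, β u = i ∧ u ∉ F) : LinearIndependent ℝ (fun v : F => φ v) := by
  rw [Fintype.linearIndependent_iff]
  intro c hc v
  let y : V → ℝ := fun u => if hu : u ∈ F then c ⟨u, hu⟩ else 0
  have hy : ∑ u, y u • φ u = 0 := by
    rw [← hc, ← Finset.sum_subset (Finset.subset_univ F), ← Finset.sum_coe_sort F]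
    · exact Finset.sum_congr rfl fun u _ => by simp [y]
    · intro u _ hu
      simp [y, hu]
  obtain ⟨u, hu, huF⟩ := hF (β v)
  -- The coefficients of a vanishing combination are constant on blocks, and the one at `u` is zero.
  have h1 := h.inner_sum_smul y v
  have h2 := h.inner_sum_smul y u
  rw [hy, inner_zero_right] at h1 h2
  rw [hu] at h2
  have h3 : y u = 0 := by simp [y, huF]
  have h4 : y v = c v := by simp [y]
  linarith

end IsBlockFrame

end BlockFrame

/-! ### Faces of the polytope -/

section Faces

/-- The face of a polytope on which a linear functional is maximal is spanned by the vertices on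
which it is maximal. -/
theorem setOf_maximal_convexHull_range {V E : Type*} [NormedAddCommGroup E] [NormedSpace ℝ E]
    (φ : V → E) (l : StrongDual ℝ E) :
    {x ∈ convexHull ℝ (Set.range φ) | ∀ y ∈ convexHull ℝ (Set.range φ), l y ≤ l x} =
      convexHull ℝ (φ '' {v | ∀ u, l (φ u) ≤ l (φ v)}) := by
  apply Set.Subset.antisymm
  · rintro x ⟨hx, hmax⟩
    obtain ⟨κ, _, w, z, hw0, hw1, hz, rfl⟩ := mem_convexHull_iff_exists_fintype.1 hx
    set x := ∑ i, w i • z i with hxdef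
    have hle : ∀ i, l (z i) ≤ l x := fun i => hmax _ (subset_convexHull ℝ _ (hz i))
    -- A convex combination reaching the maximum puts no weight on points below it.
    have hsum : ∑ i, w i * (l x - l (z i)) = 0 := by
      simp_rw [mul_sub]
      rw [Finset.sum_sub_distrib, ← Finset.sum_mul, hw1, hxdef, map_sum]
      simp
    have hzero := (Finset.sum_eq_zero_iff_of_nonneg fun i _ =>
      mul_nonneg (hw0 i) (sub_nonneg.2 (hle i))).1 hsum
    classical
    rw [hxdef, ← Finset.sum_subset (Finset.subset_univ (Finset.univ.filter fun i => w i ≠ 0))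
      (fun i _ hi => by
        have : w i = 0 := by simpa using hi
        rw [this, zero_smul])]
    refine (convex_convexHull ℝ _).sum_mem (fun i _ => hw0 i) (by rwa [Finset.sum_filter_ne_zero])
      fun i hi => subset_convexHull ℝ _ ?_
    obtain ⟨v, hv⟩ := hz i
    refine ⟨v, fun u => ?_, hv⟩
    have hi0 := (Finset.mem_filter.1 hi).2
    have : l (z i) = l x := by
      rcases mul_eq_zero.1 (hzero i (Finset.mem_univ i)) with h | h
      · exact (hi0 h).elim
      · linarith
    rw [hv, this]
    exact hmax _ (subset_convexHull ℝ _ ⟨u, rfl⟩)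
  · have hexp : IsExposed ℝ (convexHull ℝ (Set.range φ))
        {x ∈ convexHull ℝ (Set.range φ) | ∀ y ∈ convexHull ℝ (Set.range φ), l y ≤ l x} :=
      fun _ => ⟨l, rfl⟩
    refine convexHull_min ?_ (hexp.convex (convex_convexHull ℝ _))
    rintro _ ⟨v, hv, rfl⟩
    refine ⟨subset_convexHull ℝ _ ⟨v, rfl⟩, fun y hy => ?_⟩
    have hsub : convexHull ℝ (Set.range φ) ⊆ {y | l y ≤ l (φ v)} := by
      refine convexHull_min ?_ (convex_halfSpace_le l.toLinearMap.isLinear _)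
      rintro _ ⟨u, rfl⟩
      exact hv u
    exact hsub hy

/-- A set that contains no block is the set of maximizers of a function with sum zero over every
block. -/
theorem exists_weight_sum_block_eq_zero {V ι : Type*} [Fintype V] [DecidableEq V] [DecidableEq ι]
    (β : V → ι) (F : Finset V) (hF : ∀ i, ∃ u, β u = i ∧ u ∉ F) :
    ∃ y : V → ℝ, (∀ i, ∑ u ∈ Finset.univ.filter (fun w => β w = i), y u = 0) ∧
      (∀ v ∈ F, y v = 1) ∧ ∀ v ∉ F, y v ≤ 0 := by
  -- In block `i` the `p i` ones on `F` are balanced by the value `-(p i / q i)` on the `q i`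
  -- remaining vertices.
  let p : ι → ℝ := fun i => ((Finset.univ.filter fun w => β w = i).filter (· ∈ F)).card
  let q : ι → ℝ := fun i => ((Finset.univ.filter fun w => β w = i).filter (· ∉ F)).card
  refine ⟨fun v => if v ∈ F then 1 else -(p (β v) / q (β v)), fun i => ?_,
    fun v hv => if_pos hv, fun v hv => ?_⟩
  · obtain ⟨u, hu, huF⟩ := hF i
    have hq : q i ≠ 0 := by
      have : 0 < ((Finset.univ.filter fun w => β w = i).filter (· ∉ F)).card :=
        Finset.card_pos.2 ⟨u, by simp [hu, huF]⟩
      exact Nat.cast_ne_zero.2 this.ne'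
    rw [Finset.sum_ite, Finset.sum_congr rfl (g := fun _ => -(p i / q i)) (s₁ :=
      (Finset.univ.filter fun w => β w = i).filter (· ∉ F)) (fun v hv => by
        rw [(Finset.mem_filter.1 (Finset.mem_filter.1 hv).1).2])]
    rw [Finset.sum_const, Finset.sum_const, nsmul_eq_mul, nsmul_eq_mul]
    change p i * 1 + q i * -(p i / q i) = 0
    field_simp
    ring
  · change (if v ∈ F then 1 else -(p (β v) / q (β v))) ≤ 0
    rw [if_neg hv, neg_nonpos]
    positivity

open scoped RealInnerProductSpace

theorem IsBlockFrame.isPolytopalRealization {V ι E : Type*} [Fintype V] [DecidableEq V]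
    [Nonempty V] [Fintype ι] [DecidableEq ι] [NormedAddCommGroup E] [InnerProductSpace ℝ E]
    {β : V → ι} {φ : V → E} (h : IsBlockFrame β φ)
    (hβ : ∀ i, ∃ u v, u ≠ v ∧ β u = i ∧ β v = i) {K : AbstractSimplicialComplex V}
    (hK : ∀ F : Finset V, F ∈ K.faces ↔ F.Nonempty ∧ ∀ i, ∃ u, β u = i ∧ u ∉ F) :
    IsPolytopalRealization K φ := by
  have hfaces : ∀ B : Set E, (B.Nonempty ∧ B ≠ convexHull ℝ (Set.range φ) ∧
      IsExposed ℝ (convexHull ℝ (Set.range φ)) B) ↔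
        ∃ F ∈ K.faces, B = convexHull ℝ (φ '' (F : Set V)) := by
    intro B
    constructor
    · rintro ⟨hne, hproper, hexp⟩
      obtain ⟨l, hl⟩ := hexp hne
      rw [setOf_maximal_convexHull_range] at hl
      classical
      let F : Finset V := Finset.univ.filter fun v => ∀ u, l (φ u) ≤ l (φ v)
      have hF : (F : Set V) = {v | ∀ u, l (φ u) ≤ l (φ v)} := by
        ext v
        simp [F]
      rw [← hF] at hl
      refine ⟨F, (hK F).2 ⟨?_, ?_⟩, hl⟩
      · rw [hl, convexHull_nonempty_iff, Set.image_nonempty] at hne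
        exact_mod_cast hne
      · by_contra! hcon
        obtain ⟨i, hi⟩ := hcon
        -- If the maximizers contain a whole block, its zero sum makes the maximum zero. All values
        -- are then nonpositive with zero block sums, so `l` vanishes at every vertex and the face
        -- is the whole polytope.
        have hsum : ∀ i, ∑ v ∈ Finset.univ.filter (fun w => β w = i), l (φ v) = 0 := by
          intro i
          rw [← map_sum, h.sum_block, map_zero]
        obtain ⟨a, -, -, ha, -⟩ := hβ i
        have hmax : ∀ v u, β v = i → l (φ u) ≤ l (φ v) := by
          intro v u hv
          have : v ∈ F := hi v hv
          exact (Finset.mem_filter.1 this).2 u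
        have ha0 : l (φ a) = 0 := by
          have h1 := hsum i
          rw [Finset.sum_congr rfl (g := fun _ => l (φ a)) (fun v hv =>
            le_antisymm (hmax a v ha) (hmax v a (Finset.mem_filter.1 hv).2)),
            Finset.sum_const, nsmul_eq_mul, mul_eq_zero] at h1
          refine h1.resolve_left ?_
          rw [← ha]
          exact (card_block_pos β a).ne'
        have hnonpos : ∀ v, l (φ v) ≤ 0 := fun v => ha0 ▸ hmax a v ha
        have hzero : ∀ v, l (φ v) = 0 := fun v =>
          (Finset.sum_eq_zero_iff_of_nonpos fun u _ => hnonpos u).1 (hsum (β v)) v (by simp)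
        apply hproper
        rw [hl, hF, ← Set.image_univ]
        congr 2
        ext v
        simp [hzero]
    · rintro ⟨F, hF, rfl⟩
      obtain ⟨⟨v, hv⟩, hFβ⟩ := (hK F).1 hF
      obtain ⟨y, hy, hy1, hy0⟩ := exists_weight_sum_block_eq_zero β F hFβ
      obtain ⟨x, hx⟩ := h.exists_inner_eq y hy
      have hl : ∀ u, innerSL ℝ x (φ u) = y u := fun u => by
        rw [innerSL_apply_apply, real_inner_comm, hx]
      have hFmax : (F : Set V) = {v | ∀ u, innerSL ℝ x (φ u) ≤ innerSL ℝ x (φ v)} := by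
        ext w
        simp only [hl, Finset.mem_coe, Set.mem_ofPred_eq]
        constructor
        · intro hw u
          rw [hy1 w hw]
          by_cases hu : u ∈ F
          · exact (hy1 u hu).le
          · linarith [hy0 u hu]
        · intro hw
          by_contra hwF
          linarith [hy0 w hwF, hw v, hy1 v hv]
      rw [hFmax, ← setOf_maximal_convexHull_range]
      refine ⟨?_, fun heq => ?_, fun _ => ⟨_, rfl⟩⟩
      · rw [setOf_maximal_convexHull_range, ← hFmax]
        exact ⟨φ v, subset_convexHull ℝ _ ⟨v, hv, rfl⟩⟩
      -- The face is proper because some vertex lies outside `F`, where the functional is at most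
      -- `0` instead of `1`.
      · obtain ⟨u, -, hu⟩ := hFβ (β v)
        have hmem : φ u ∈ convexHull ℝ (Set.range φ) := subset_convexHull ℝ _ ⟨u, rfl⟩
        have hmem' := hmem
        rw [← heq] at hmem
        have := hmem.2 (φ v) (subset_convexHull ℝ _ ⟨v, rfl⟩)
        rw [hl, hl, hy1 v hv] at this
        linarith [hy0 u hu]
  refine ⟨inferInstance, h.injective hβ, ⟨0, h.zero_mem_interior⟩, ?_, fun F hF => ?_, hfaces⟩
  · refine Set.Subset.antisymm extremePoints_convexHull_subset ?_
    rintro _ ⟨v, rfl⟩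
    have := ((hfaces _).2 ⟨{v}, K.singleton_mem v, rfl⟩).2.2
    rw [Finset.coe_singleton, Set.image_singleton, convexHull_singleton] at this
    exact isExtreme_singleton.1 this.isExtreme
  · exact (h.linearIndependent ((hK F).1 hF).2).affineIndependent

end Faces

/-! ### Automorphisms and isometries -/

section Symmetry

open scoped RealInnerProductSpace

theorem image_extremePoints_affineEquiv {E : Type*} [AddCommGroup E] [Module ℝ E]
    (g : E ≃ᵃ[ℝ] E) {P : Set E} {x : E} (hx : x ∈ P.extremePoints ℝ) :
    g x ∈ (g '' P).extremePoints ℝ := by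
  rw [mem_extremePoints] at hx ⊢
  refine ⟨⟨x, hx.1, rfl⟩, ?_⟩
  rintro _ ⟨a, ha, rfl⟩ _ ⟨b, hb, rfl⟩ hab
  have himg := image_openSegment ℝ g.toAffineMap a b
  have : x ∈ openSegment ℝ a b := by
    have h1 : g x ∈ g '' openSegment ℝ a b := by
      change g x ∈ g.toAffineMap '' openSegment ℝ a b
      rw [himg]
      exact hab
    obtain ⟨y, hy, hyx⟩ := h1
    rwa [← g.injective hyx]
  have := hx.2 a ha b hb this
  exact ⟨congrArg g this.1, congrArg g this.2⟩

variable {V ι : Type*} [Fintype V] [DecidableEq V] [DecidableEq ι] {β : V → ι}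
  {K : AbstractSimplicialComplex V}

/-- The automorphisms are exactly the permutations that preserve the partition into blocks. -/
theorem mem_autGroup_iff_of_blocks (hβ : ∀ i, ∃ u v, u ≠ v ∧ β u = i ∧ β v = i)
    (hK : ∀ F : Finset V, F ∈ K.faces ↔ F.Nonempty ∧ ∀ i, ∃ u, β u = i ∧ u ∉ F)
    (σ : Equiv.Perm V) :
    σ ∈ autGroup K ↔ ∀ u v, β (σ u) = β (σ v) ↔ β u = β v := by
  have hmono : ∀ σ ∈ autGroup K, ∀ u v, β u = β v → β (σ u) = β (σ v) := by
    intro σ hσ u v huv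
    have hσ' : ∀ S : Finset V, S.map σ.toEmbedding ∈ K.faces ↔ S ∈ K.faces := hσ
    -- `B` is a minimal non-face. Its image contains some block `i`; if `σ x` were outside that
    -- block, the face `B.erase x` would have an image still containing it.
    let B : Finset V := Finset.univ.filter fun w => β w = β u
    have hB : B.map σ.toEmbedding ∉ K.faces := by
      rw [hσ', hK]
      rintro ⟨-, h⟩
      obtain ⟨w, hw, hwB⟩ := h (β u)
      exact hwB (by simp [B, hw])
    have hBne : (B.map σ.toEmbedding).Nonempty := Finset.map_nonempty.2 ⟨u, by simp [B]⟩
    rw [hK] at hB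
    push Not at hB
    obtain ⟨i, hi⟩ := hB hBne
    have hall : ∀ x, β x = β u → β (σ x) = i := by
      intro x hx
      by_contra hne
      have hface : B.erase x ∈ K.faces := by
        rw [hK]
        constructor
        · obtain ⟨a, b, hab, ha, hb⟩ := hβ (β u)
          by_cases hax : a = x
          · exact ⟨b, Finset.mem_erase.2 ⟨fun h => hab (hax.trans h.symm), by simp [B, hb]⟩⟩
          · exact ⟨a, Finset.mem_erase.2 ⟨hax, by simp [B, ha]⟩⟩
        · intro j
          by_cases hj : j = β u
          · exact ⟨x, hx.trans hj.symm, Finset.notMem_erase _ _⟩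
          · obtain ⟨a, -, -, ha, -⟩ := hβ j
            refine ⟨a, ha, fun h => hj ?_⟩
            rw [← ha]
            exact (Finset.mem_filter.1 (Finset.mem_of_mem_erase h)).2
      rw [← hσ', hK] at hface
      obtain ⟨w, hw, hwB⟩ := hface.2 i
      obtain ⟨z, hz, rfl⟩ := Finset.mem_map.1 (hi w hw)
      by_cases hzx : z = x
      · exact hne (hzx ▸ hw)
      · exact hwB (Finset.mem_map_of_mem _ (Finset.mem_erase.2 ⟨hzx, hz⟩))
    rw [hall u rfl, hall v huv.symm]
  have hface : ∀ σ : Equiv.Perm V, (∀ u v, β (σ u) = β (σ v) ↔ β u = β v) →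
      ∀ F ∈ K.faces, F.map σ.toEmbedding ∈ K.faces := by
    intro σ hσ F hF
    rw [hK] at hF ⊢
    refine ⟨Finset.map_nonempty.2 hF.1, fun i => ?_⟩
    obtain ⟨a, -, -, ha, -⟩ := hβ i
    obtain ⟨u, hu, huF⟩ := hF.2 (β (σ.symm a))
    refine ⟨σ u, ?_, fun h => huF ?_⟩
    · rw [(hσ _ _).2 hu, Equiv.apply_symm_apply, ha]
    · obtain ⟨z, hz, hzu⟩ := Finset.mem_map.1 h
      rwa [← σ.injective hzu]
  constructor
  · intro hσ u v
    refine ⟨fun h => ?_, hmono σ hσ u v⟩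
    simpa using hmono σ⁻¹ (inv_mem hσ) _ _ h
  · intro hσ S
    refine ⟨fun hS => ?_, hface σ hσ S⟩
    have h1 := hface σ⁻¹ (fun u v => by rw [← hσ]; simp) _ hS
    rw [Finset.map_map] at h1
    convert h1
    ext x
    simp

namespace IsBlockFrame

variable {E : Type*} [NormedAddCommGroup E] [InnerProductSpace ℝ E] {φ : V → E}

/-- A permutation that preserves the partition into blocks is induced by a linear isometry. -/
theorem exists_linearIsometry (h : IsBlockFrame β φ) {σ : Equiv.Perm V}
    (hσ : ∀ u v, β (σ u) = β (σ v) ↔ β u = β v) :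
    ∃ g : E →ₗᵢ[ℝ] E, ∀ v, g (φ v) = φ (σ v) := by
  have hgram : ∀ u v, ⟪φ (σ u), φ (σ v)⟫ = ⟪φ u, φ v⟫ := by
    intro u v
    rw [h.inner_eq, h.inner_eq]
    have hc : (Finset.univ.filter fun w => β w = β (σ u)).card =
        (Finset.univ.filter fun w => β w = β u).card := by
      symm
      apply Finset.card_bij (fun w _ => σ w)
      · intro w hw
        simpa [hσ] using hw
      · intro a _ b _ hab
        exact σ.injective hab
      · intro w hw
        refine ⟨σ.symm w, ?_, by simp⟩
        rw [Finset.mem_filter] at hw ⊢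
        refine ⟨Finset.mem_univ _, (hσ _ _).1 ?_⟩
        simpa using hw
    simp only [hc, hσ, σ.injective.eq_iff]
  -- The frame expansion with permuted vectors is linear by construction, although the `φ v` are
  -- linearly dependent; invariance of the Gram matrix makes it isometric.
  let L : E →ₗ[ℝ] E :=
    { toFun := fun x => ∑ v, ⟪φ v, x⟫ • φ (σ v)
      map_add' := fun x y => by simp_rw [inner_add_right, add_smul, Finset.sum_add_distrib]
      map_smul' := fun c x => by
        simp_rw [inner_smul_right, mul_smul, ← Finset.smul_sum, RingHom.id_apply] }
  have hL : ∀ x, L x = ∑ v, ⟪φ v, x⟫ • φ (σ v) := fun _ => rfl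
  refine ⟨L.isometryOfInner fun x y => ?_, fun v => ?_⟩
  · conv_rhs => rw [← h.sum_smul x, ← h.sum_smul y]
    rw [hL, hL]
    simp_rw [sum_inner, inner_sum, inner_smul_left, inner_smul_right, hgram]
  · change L (φ v) = _
    rw [hL]
    conv_rhs => rw [← h.sum_smul (φ (σ v)), ← Equiv.sum_comp σ]
    simp_rw [hgram]

variable [Fintype ι] [Nonempty V]

theorem exists_autGroup_of_isometry (h : IsBlockFrame β φ)
    (hβ : ∀ i, ∃ u v, u ≠ v ∧ β u = i ∧ β v = i)
    (hK : ∀ F : Finset V, F ∈ K.faces ↔ F.Nonempty ∧ ∀ i, ∃ u, β u = i ∧ u ∉ F)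
    {g : E ≃ᵢ E} (hg : g ∈ isometryGroupOf (convexHull ℝ (Set.range φ))) :
    ∃ σ ∈ autGroup K, ∀ v, g (φ v) = φ (σ v) := by
  have hg' : g '' convexHull ℝ (Set.range φ) = convexHull ℝ (Set.range φ) := hg
  have hvert := (h.isPolytopalRealization hβ hK).vertices
  have hmem : ∀ v, ∃ u, φ u = g (φ v) := by
    intro v
    have hv : φ v ∈ (convexHull ℝ (Set.range φ)).extremePoints ℝ := by
      rw [hvert]; exact ⟨v, rfl⟩
    -- By the Mazur–Ulam theorem `g` is affine, so it preserves extreme points.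
    have := image_extremePoints_affineEquiv g.toRealAffineIsometryEquiv.toAffineEquiv hv
    have hcoe : (g.toRealAffineIsometryEquiv.toAffineEquiv : E → E) = g := rfl
    rw [hcoe, hg', hvert] at this
    exact this
  choose f hf using hmem
  have hinj := h.injective hβ
  have hfinj : Function.Injective f := fun a b hab =>
    hinj (g.injective (by rw [← hf, ← hf, hab]))
  let σ : Equiv.Perm V := Equiv.ofBijective f (Finite.injective_iff_bijective.1 hfinj)
  have hσ : ∀ v, g (φ v) = φ (σ v) := fun v => (hf v).symm
  refine ⟨σ, (mem_autGroup_iff_of_blocks hβ hK σ).2 fun u v => ?_, hσ⟩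
  by_cases huv : u = v
  · simp [huv]
  · rw [← h.dist_sq_eq_two_iff huv, ← h.dist_sq_eq_two_iff (σ.injective.ne huv), ← hσ, ← hσ,
      g.isometry.dist_eq]

/-- Injectivity holds because the vertices affinely span the space, surjectivity because
block-preserving permutations extend to linear isometries. -/
theorem exists_mulEquiv_autGroup [FiniteDimensional ℝ E] (h : IsBlockFrame β φ)
    (hβ : ∀ i, ∃ u v, u ≠ v ∧ β u = i ∧ β v = i)
    (hK : ∀ F : Finset V, F ∈ K.faces ↔ F.Nonempty ∧ ∀ i, ∃ u, β u = i ∧ u ∉ F) :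
    ∃ Φ : isometryGroupOf (convexHull ℝ (Set.range φ)) ≃* autGroup K,
      ∀ (g : isometryGroupOf (convexHull ℝ (Set.range φ))) (v : V),
        (g : E ≃ᵢ E) (φ v) = φ ((Φ g : Equiv.Perm V) v) := by
  have hinj := h.injective hβ
  choose s hs using fun g : isometryGroupOf (convexHull ℝ (Set.range φ)) =>
    h.exists_autGroup_of_isometry hβ hK g.2
  let Φ : isometryGroupOf (convexHull ℝ (Set.range φ)) →* autGroup K :=
    MonoidHom.mk' (fun g => ⟨s g, (hs g).1⟩) fun g g' => by
      refine Subtype.ext (Equiv.ext fun v => hinj ?_)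
      change φ (s (g * g') v) = φ (s g (s g' v))
      rw [← (hs _).2, ← (hs _).2, ← (hs _).2]
      rfl
  have hΦ : ∀ (g : isometryGroupOf (convexHull ℝ (Set.range φ))) (v : V),
      (g : E ≃ᵢ E) (φ v) = φ ((Φ g : Equiv.Perm V) v) := fun g => (hs g).2
  refine ⟨MulEquiv.ofBijective Φ ⟨fun g g' hgg' => ?_, fun σ => ?_⟩, hΦ⟩
  · have hspan : affineSpan ℝ (Set.range φ) = ⊤ :=
      interior_convexHull_nonempty_iff_affineSpan_eq_top.1 ⟨0, h.zero_mem_interior⟩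
    have := AffineMap.ext_on hspan (f := (g : E ≃ᵢ E).toRealAffineIsometryEquiv.toAffineMap)
      (g := (g' : E ≃ᵢ E).toRealAffineIsometryEquiv.toAffineMap) (by
        rintro _ ⟨v, rfl⟩
        change (g : E ≃ᵢ E) (φ v) = (g' : E ≃ᵢ E) (φ v)
        rw [hΦ, hΦ, hgg'])
    exact Subtype.ext (IsometryEquiv.ext fun x => DFunLike.congr_fun this x)
  · obtain ⟨L, hL⟩ := h.exists_linearIsometry ((mem_autGroup_iff_of_blocks hβ hK σ).1 σ.2)
    let e : E ≃ₗᵢ[ℝ] E := L.toLinearIsometryEquiv rfl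
    have he : ∀ v, e (φ v) = φ ((σ : Equiv.Perm V) v) := hL
    have hmem : e.toIsometryEquiv ∈ isometryGroupOf (convexHull ℝ (Set.range φ)) := by
      change e.toLinearEquiv.toLinearMap '' convexHull ℝ (Set.range φ) = _
      rw [LinearMap.image_convexHull, ← Set.range_comp]
      congr 1
      rw [← (σ : Equiv.Perm V).surjective.range_comp φ]
      exact congrArg Set.range (funext he)
    refine ⟨⟨e.toIsometryEquiv, hmem⟩, Subtype.ext (Equiv.ext fun v => hinj ?_)⟩
    rw [← hΦ]
    exact he v

end IsBlockFrame

end Symmetry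

/-! ### Construction of block frames and their polar duals -/

section Existence

open scoped RealInnerProductSpace

/-- The vertices of a regular simplex centred at the origin, scaled such that they form a tight
frame. -/
theorem exists_simplexFrame (m : ℕ) :
    ∃ ψ : Fin (m + 1) → EuclideanSpace ℝ (Fin m), IsBlockFrame (fun _ => ()) ψ := by
  let one : EuclideanSpace ℝ (Fin (m + 1)) := WithLp.toLp 2 fun _ => 1
  have hone : one ≠ 0 := by
    intro h
    have : one 0 = 0 := by rw [h]; rfl
    exact one_ne_zero this
  have : Fact (Module.finrank ℝ (EuclideanSpace ℝ (Fin (m + 1))) = m + 1) := ⟨by simp⟩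
  let p : Submodule ℝ (EuclideanSpace ℝ (Fin (m + 1))) := (ℝ ∙ one)ᗮ
  let T : p ≃ₗᵢ[ℝ] EuclideanSpace ℝ (Fin m) :=
    (OrthonormalBasis.fromOrthogonalSpanSingleton (𝕜 := ℝ) m hone).repr
  have hinner : ∀ x, ⟪one, x⟫ = ∑ j, x j := fun x => by simp [PiLp.inner_apply, one]
  have hp : ∀ x, x ∈ p ↔ ∑ j, x j = 0 := fun x => by
    rw [← hinner]
    exact Submodule.mem_orthogonal_singleton_iff_inner_right
  have hm' : (m : ℝ) + 1 ≠ 0 := by positivity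
  -- `q j` is the orthogonal projection of the `j`-th basis vector to the sum-zero hyperplane `p`,
  -- so pairing with it reads off the `j`-th coordinate on `p`.
  let q : Fin (m + 1) → EuclideanSpace ℝ (Fin (m + 1)) := fun j =>
    WithLp.toLp 2 fun k => (if k = j then 1 else 0) - ((m : ℝ) + 1)⁻¹
  have hq : ∀ j, q j ∈ p := fun j => by
    rw [hp]
    simp [q, hm']
  have hqy : ∀ j, ∀ y ∈ p, ⟪q j, y⟫ = y j := by
    intro j y hy
    rw [hp] at hy
    simp only [PiLp.inner_apply, q, RCLike.inner_apply, conj_trivial, mul_sub,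
      Finset.sum_sub_distrib, ← Finset.sum_mul, hy]
    simp
  refine ⟨fun j => T ⟨q j, hq j⟩, ⟨fun u v => ?_, fun x => ?_⟩⟩
  · rw [LinearIsometryEquiv.inner_map_map, Submodule.coe_inner, hqy u _ (hq v)]
    simp [q]
  · obtain ⟨y, rfl⟩ := T.surjective x
    simp_rw [LinearIsometryEquiv.inner_map_map, Submodule.coe_inner, hqy _ _ y.2, ← map_smul,
      ← map_sum]
    congr 1
    ext k
    have hy := (hp _).1 y.2
    simp only [Submodule.coe_sum, Submodule.coe_smul, WithLp.ofLp_sum, WithLp.ofLp_smul,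
      Finset.sum_apply, Pi.smul_apply, smul_eq_mul, q, mul_sub, Finset.sum_sub_distrib,
      ← Finset.sum_mul, hy]
    simp

/-- The reciprocal of a simplex frame is a regular simplex. -/
theorem IsBlockFrame.exists_equilateral {m : ℕ}
    {ψ : Fin (m + 1) → EuclideanSpace ℝ (Fin m)} (h : IsBlockFrame (fun _ => ()) ψ) :
    ∃ Δ : Affine.Simplex ℝ (EuclideanSpace ℝ (Fin m)) m, Δ.Equilateral ∧
      {x | ∀ j, ⟪ψ j, x⟫ ≤ 1} = convexHull ℝ (Set.range Δ.points) := by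
  have hsum := h.sum_eq_zero
  have hm' : (0 : ℝ) < m + 1 := by positivity
  have hinner : ∀ u v, ⟪ψ u, ψ v⟫ = (if u = v then 1 else 0) - ((m : ℝ) + 1)⁻¹ := by
    intro u v
    rw [h.inner_eq]
    simp
  -- The factor `-(m + 1)` makes the pairing with `ψ j` equal to `1` at every vertex except the
  -- `j`-th, where it is `-m`: each vertex is opposite to one facet of the dual.
  have hind : AffineIndependent ℝ fun j => -((m : ℝ) + 1) • ψ j := by
    rw [affineIndependent_iff]
    intro s w hw hw0 j hj
    have h1 : ⟪ψ j, ∑ i ∈ s, w i • (-((m : ℝ) + 1)) • ψ i⟫ = -((m : ℝ) + 1) * w j := by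
      simp_rw [inner_sum, inner_smul_right, hinner, mul_sub]
      rw [Finset.sum_sub_distrib, ← Finset.sum_mul, hw]
      simp [hj, mul_comm]
    rw [hw0, inner_zero_right] at h1
    rcases mul_eq_zero.1 h1.symm with h2 | h2
    · linarith
    · exact h2
  refine ⟨⟨_, hind⟩, ⟨((m : ℝ) + 1) * √2, fun i j hij => ?_⟩, ?_⟩
  · change dist (-((m : ℝ) + 1) • ψ i) (-((m : ℝ) + 1) • ψ j) = _
    rw [dist_smul₀, norm_neg, Real.norm_of_nonneg hm'.le,
      ← (h.dist_sq_eq_two_iff hij).2 rfl, Real.sqrt_sq dist_nonneg]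
  · change _ = convexHull ℝ (Set.range fun j => -((m : ℝ) + 1) • ψ j)
    apply Set.Subset.antisymm
    · intro x hx
      -- These are the barycentric coordinates of `x`; the defining inequalities say that they are
      -- nonnegative.
      refine mem_convexHull_of_exists_fintype (fun j => (1 - ⟪ψ j, x⟫) * ((m : ℝ) + 1)⁻¹) _
        (fun j => mul_nonneg (sub_nonneg.2 (hx j)) (inv_nonneg.2 hm'.le)) ?_
        (fun j => Set.mem_range_self j) ?_
      · rw [← Finset.sum_mul, Finset.sum_sub_distrib, ← sum_inner, hsum, inner_zero_left]
        simp
        field_simp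
      · have h1 : ∀ j, ((1 - ⟪ψ j, x⟫) * ((m : ℝ) + 1)⁻¹) • -((m : ℝ) + 1) • ψ j =
            ⟪ψ j, x⟫ • ψ j - ψ j := by
          intro j
          rw [smul_smul, mul_assoc, mul_neg, inv_mul_cancel₀ hm'.ne']
          module
        simp_rw [h1]
        rw [Finset.sum_sub_distrib, h.sum_smul, hsum, sub_zero]
    · refine convexHull_min ?_ ?_
      · rintro _ ⟨i, rfl⟩ j
        rw [inner_smul_right, hinner, mul_sub, neg_mul _ (_⁻¹), mul_inv_cancel₀ hm'.ne']
        split_ifs <;> linarith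
      · simp only [Set.ofPred_forall]
        exact convex_iInter fun j => convex_halfSpace_le (innerSL ℝ (ψ j)).toLinearMap.isLinear 1

theorem polarDual_convexHull {E : Type*} [NormedAddCommGroup E] [InnerProductSpace ℝ E]
    (s : Set E) : polarDual (convexHull ℝ s) = polarDual s := by
  refine Set.Subset.antisymm (fun y hy x hx => hy x (subset_convexHull ℝ s hx)) fun y hy x hx => ?_
  have hsub : convexHull ℝ s ⊆ {x | ⟪y, x⟫ ≤ 1} :=
    convexHull_min (fun x hx => by rw [Set.mem_ofPred_eq, real_inner_comm]; exact hy x hx)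
      (convex_halfSpace_le (innerSL ℝ y).toLinearMap.isLinear 1)
  rw [real_inner_comm]
  exact hsub hx

/-- Every partition of a finite set into blocks with at least two elements has a block frame, whose
polar dual is a product of regular simplices. -/
theorem exists_blockFrame {V : Type*} [Fintype V] [Nonempty V] [DecidableEq V] {n t : ℕ}
    (β : V → Fin t) (hβ : ∀ i, ∃ u v, u ≠ v ∧ β u = i ∧ β v = i) (hcard : Nat.card V = n + t) :
    ∃ φ : V → EuclideanSpace ℝ (Fin n), IsBlockFrame β φ ∧
      IsPolarDualOfSimplexProduct (convexHull ℝ (Set.range φ)) := by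
  let m : Fin t → ℕ := fun i => (Finset.univ.filter fun w => β w = i).card - 1
  have hm1 : ∀ i, 1 < (Finset.univ.filter fun w => β w = i).card := fun i => by
    obtain ⟨u, v, huv, hu, hv⟩ := hβ i
    exact Finset.one_lt_card.2 ⟨u, by simp [hu], v, by simp [hv], huv⟩
  have hm0 : ∀ i, 0 < m i := fun i => Nat.sub_pos_of_lt (hm1 i)
  have hm : ∀ i, m i + 1 = (Finset.univ.filter fun w => β w = i).card :=
    fun i => Nat.sub_add_cancel (hm1 i).le
  have hsum : ∑ i, m i = n := by
    have h1 : ∑ i, (m i + 1) = Fintype.card V := by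
      simp_rw [hm]
      rw [← Finset.card_univ]
      exact (Finset.card_eq_sum_card_fiberwise fun _ _ => Finset.mem_univ _).symm
    rw [Finset.sum_add_distrib, ← Nat.card_eq_fintype_card, hcard] at h1
    simpa using h1
  let ε : ∀ i, {w // β w = i} ≃ Fin (m i + 1) := fun i =>
    Fintype.equivFinOfCardEq (by rw [Fintype.card_subtype, hm])
  let ψ : ∀ i, Fin (m i + 1) → EuclideanSpace ℝ (Fin (m i)) := fun i =>
    (exists_simplexFrame (m i)).choose
  have hψ : ∀ i, IsBlockFrame (fun _ => ()) (ψ i) := fun i => (exists_simplexFrame (m i)).choose_spec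
  -- Each block gets its own orthogonal summand, of dimension one less than its size.
  let χ : V → PiLp 2 (fun i => EuclideanSpace ℝ (Fin (m i))) := fun v =>
    PiLp.single 2 (β v) (ψ (β v) (ε (β v) ⟨v, rfl⟩))
  have hχ : ∀ v i (hv : β v = i), (χ v) i = ψ i (ε i ⟨v, hv⟩) := by
    rintro v _ rfl
    exact PiLp.single_eq_same ..
  have hχ0 : ∀ v i, β v ≠ i → (χ v) i = 0 := fun v i hv => PiLp.single_eq_of_ne' _ hv _
  have hinner : ∀ v i (hv : β v = i) x, ⟪χ v, x⟫ = ⟪ψ i (ε i ⟨v, hv⟩), x i⟫ := by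
    intro v i hv x
    rw [PiLp.inner_apply, Finset.sum_eq_single i, hχ v i hv]
    · intro j _ hj
      rw [hχ0 v j (fun h => hj (h.symm.trans hv)), inner_zero_left]
    · simp
  have hframe : IsBlockFrame β χ := by
    refine ⟨fun u v => ?_, fun x => ?_⟩
    · rw [hinner u _ rfl]
      by_cases hb : β v = β u
      · rw [hχ v _ hb, (hψ _).inner_eq, if_pos hb.symm, ← hm]
        simp
      · rw [hχ0 v _ hb, inner_zero_right, if_neg (Ne.symm hb), if_neg, sub_zero]
        rintro rfl
        exact hb rfl
    · refine PiLp.ext fun i => ?_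
      rw [← (hψ i).sum_smul (x i), ← Equiv.sum_comp (ε i), WithLp.ofLp_sum, Finset.sum_apply,
        ← Finset.sum_subset (Finset.subset_univ (Finset.univ.filter fun w => β w = i)),
        Finset.sum_subtype (p := fun w => β w = i) _ (fun w => by simp)]
      · refine Finset.sum_congr rfl fun w _ => ?_
        rw [PiLp.smul_apply, hχ _ i w.2, hinner _ i w.2]
      · intro v _ hv
        rw [PiLp.smul_apply, hχ0 v i (fun h => hv (by simp [h])), smul_zero]
  have hrank : Module.finrank ℝ (PiLp 2 (fun i => EuclideanSpace ℝ (Fin (m i)))) = n := by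
    rw [(WithLp.linearEquiv 2 ℝ (∀ i, EuclideanSpace ℝ (Fin (m i)))).finrank_eq,
      Module.finrank_pi_fintype]
    simp [hsum]
  let e : EuclideanSpace ℝ (Fin n) ≃ₗᵢ[ℝ] PiLp 2 (fun i => EuclideanSpace ℝ (Fin (m i))) :=
    
    ((stdOrthonormalBasis ℝ _).reindex (finCongr hrank)).repr.symm
  have hφ : IsBlockFrame β (fun v => e.symm (χ v)) := by
    refine ⟨fun u v => ?_, fun x => ?_⟩
    · rw [LinearIsometryEquiv.inner_map_map, hframe.inner_eq]
    · apply e.injective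
      rw [map_sum, ← hframe.sum_smul (e x)]
      refine Finset.sum_congr rfl fun v _ => ?_
      rw [map_smul, ← LinearIsometryEquiv.inner_map_map e, LinearIsometryEquiv.apply_symm_apply]
  choose Δ hΔ hΔ' using fun i => (hψ i).exists_equilateral
  refine ⟨_, hφ, hφ.zero_mem_interior, t, m, Δ, e, fun i => ⟨hm0 i, hΔ i⟩, ?_⟩
  rw [polarDual_convexHull]
  ext x
  simp only [← hΔ', Set.mem_ofPred_eq]
  constructor
  -- The inequality at a vertex involves only the component of its own block.
  · rintro ⟨y, hy, rfl⟩ i j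
    have h1 := hy _ ⟨(ε i).symm j, rfl⟩
    rw [← LinearIsometryEquiv.inner_map_map e, LinearIsometryEquiv.apply_symm_apply,
      hinner _ i ((ε i).symm j).2] at h1
    simpa using h1
  · intro hx
    refine ⟨e.symm x, ?_, e.apply_symm_apply x⟩
    rintro _ ⟨v, rfl⟩
    rw [LinearIsometryEquiv.inner_map_map, hinner v _ rfl]
    exact hx _ _

end Existence

theorem proposition2p6 {V : Type*} (K : AbstractSimplicialComplex V) (n : ℕ)
    (hK : IsType34 K n) :
    ∃ φ : V → EuclideanSpace ℝ (Fin (n + 1)),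
      IsPolytopalRealization K φ ∧
      (∃ Φ : isometryGroupOf (convexHull ℝ (Set.range φ)) ≃* autGroup K,
        ∀ (g : isometryGroupOf (convexHull ℝ (Set.range φ))) (v : V),
          (g : EuclideanSpace ℝ (Fin (n + 1)) ≃ᵢ EuclideanSpace ℝ (Fin (n + 1))) (φ v) =
            φ ((Φ g : Equiv.Perm V) v)) ∧
      IsPolarDualOfSimplexProduct (convexHull ℝ (Set.range φ)) := by
  classical
  obtain ⟨_, t, β, hβ, hcard, hfaces⟩ := hK.exists_block_structure
  have := Fintype.ofFinite V
  have : Nonempty V := (Nat.card_pos_iff.1 (by omega)).1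
  obtain ⟨φ, hφ, hpolar⟩ := exists_blockFrame β hβ hcard
  exact ⟨φ, hφ.isPolytopalRealization hβ hfaces, hφ.exists_mulEquiv_autGroup hβ hfaces, hpolar⟩
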